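/- Let $\mathcal G$ be a compact connected metric graph, i.e. a connected space obtained from finitely many (at least one) segments $I_e=[0,\ell_e]$, $0<\ell_e<\infty$, called edges, by gluing some of their endpoints together at vertices (loops and multiple edges are allowed), and let $\ell=\sum_e\ell_e$ be its total length. Let $H^1(\mathcal G)$ be the space of continuous functions $u:\mathcal G\to\mathbb C$ whose restriction $u_e$ to every edge $e$ belongs to $H^1(I_e)$. For $p\in(2,6]$ put $$E(u)=\frac12\sum_e\int_{I_e}|u_e'|^2\,dx-\frac1p\sum_e\int_{I_e}|u_e|^p\,dx,\qquad u\in H^1(\mathcal G),$$ and for $\mu\ge 0$ let $H^1_\mu(\mathcal G)=\{u\in H^1(\mathcal G):\sum_e\int_{I_e}|u_e|^2\,dx=\mu\}$. A function $u\in H^1_\mu(\mathcal G)$ is called a ground state of mass $\mu$ if 1. $E(u)=\inf_{v\in H^1_\mu(\mathcal G)}E(v)$, and 2. it is a stationary state: $u_e\in H^2(I_e)$ for every edge $e$, at every vertex the sum of the outgoing derivatives of $u$ along the edges ending there is zero (a loop counting with both ends), and $u''+|u|^{p-2}u-\lambda u=0$ on every edge for some $\lambda\in\mathbb R$. Then for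 every $p\in(2,6]$ and every such $\mathcal G$ there is $\mu_2=\mu_2(\mathcal G,p)>0$ such that, for every $\mu\in[0,\mu_2)$, the constant function $\kappa_\mu=\sqrt{\mu/\ell}$ is a ground state of mass $\mu$. -/

import Mathlib

open MeasureTheory
open scoped ContDiff

noncomputable section

/-- A connected metric graph without half-lines: each edge `e` is a segment `[0, len e]` whose
endpoints `0` and `len e` are glued to the vertices `src e` and `tgt e`. Loops and multiple edges
are allowed. It is compact when the type `E` of edges is finite. -/
structure MetricGraph (V E : Type*) where
  src : E → V
  tgt : E → V
  len : E → ℝ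
  len_pos : ∀ e, 0 < len e
  connected : ∀ v w : V, Relation.EqvGen (fun a b => ∃ e, src e = a ∧ tgt e = b) v w

namespace MetricGraph

variable {V E : Type*} (G : MetricGraph V E)

/-- The disjoint union of the edges, before gluing. -/
abbrev Seg : Type _ := Σ e : E, Set.Icc (0 : ℝ) (G.len e)

/-- The point `x` of the disjoint union is an endpoint of its edge, attached to the vertex `v`. -/
def AtVertex (x : G.Seg) (v : V) : Prop :=
  ((x.2 : ℝ) = 0 ∧ G.src x.1 = v) ∨ ((x.2 : ℝ) = G.len x.1 ∧ G.tgt x.1 = v)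

/-- Two points of the disjoint union are glued when they are endpoints at a common vertex. -/
def Glued (x y : G.Seg) : Prop := ∃ v, G.AtVertex x v ∧ G.AtVertex y v

/-- The metric graph as a set of points, with the quotient topology. -/
def Point : Type _ := Quot G.Glued

instance : TopologicalSpace G.Point := inferInstanceAs (TopologicalSpace (Quot G.Glued))

/-- The point of coordinate `t` on the edge `e`. -/
def pt (e : E) (t : Set.Icc (0 : ℝ) (G.len e)) : G.Point := Quot.mk G.Glued ⟨e, t⟩

variable {G}

/-- The restriction `u_e` of `u` to the edge `e`, as a function on `[0, len e]` that is extended to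
`ℝ` by its values at the endpoints. -/
def restr (u : G.Point → ℂ) (e : E) : ℝ → ℂ :=
  Set.IccExtend (G.len_pos e).le (fun t => u (G.pt e t))

end MetricGraph

/-- `g ∈ L²(0, ℓ)` is the weak derivative of `f` on the interval `(0, ℓ)`. -/
def IsWeakDeriv (l : ℝ) (f g : ℝ → ℂ) : Prop :=
  MemLp g 2 (volume.restrict (Set.Ioo 0 l)) ∧
  ∀ φ : ℝ → ℝ, ContDiff ℝ ∞ φ → HasCompactSupport φ → tsupport φ ⊆ Set.Ioo 0 l →
    ∫ t in Set.Ioo 0 l, deriv φ t • f t = - ∫ t in Set.Ioo 0 l, φ t • g t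

/-- `f ∈ H¹(0, ℓ)`. -/
def MemSobolev1 (l : ℝ) (f : ℝ → ℂ) : Prop :=
  MemLp f 2 (volume.restrict (Set.Ioo 0 l)) ∧ ∃ g, IsWeakDeriv l f g

open Classical in
/-- The weak derivative of `f` on `(0, ℓ)`, unique up to a null set (and `0` if there is none). -/
def weakDeriv (l : ℝ) (f : ℝ → ℂ) : ℝ → ℂ :=
  if h : ∃ g, IsWeakDeriv l f g then h.choose else 0

namespace MetricGraph

variable {V E : Type*} [Fintype E]

/-- The integral over the graph of a function given edge by edge. -/
def integral (G : MetricGraph V E) (f : E → ℝ → ℝ) : ℝ :=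
  ∑ e, ∫ t in Set.Ioo 0 (G.len e), f e t

/-- The total length of the graph. -/
def length (G : MetricGraph V E) : ℝ := ∑ e, G.len e

/-- The space `H¹(G)`. -/
def H1 (G : MetricGraph V E) : Set (G.Point → ℂ) :=
  {u | Continuous u ∧ ∀ e, MemSobolev1 (G.len e) (restr u e)}

/-- The mass `‖u‖₂²`. -/
def mass (G : MetricGraph V E) (u : G.Point → ℂ) : ℝ :=
  G.integral fun e t => ‖restr u e t‖ ^ 2

/-- The space `H¹_μ(G)` of functions in `H¹(G)` of mass `μ`. -/
def H1mass (G : MetricGraph V E) (μ : ℝ) : Set (G.Point → ℂ) :=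
  {u | u ∈ G.H1 ∧ G.mass u = μ}

/-- The energy `E(u) = ½ ‖u'‖₂² - (1/p) ‖u‖_p^p`. -/
def energy (G : MetricGraph V E) (p : ℝ) (u : G.Point → ℂ) : ℝ :=
  (1 / 2) * G.integral (fun e t => ‖weakDeriv (G.len e) (restr u e) t‖ ^ 2)
    - (1 / p) * G.integral (fun e t => ‖restr u e t‖ ^ p)

/-- The ground state energy level: the infimum of the energy on `H¹_μ(G)`, possibly `-∞`. -/
def groundLevel (G : MetricGraph V E) (p μ : ℝ) : EReal :=
  ⨅ u ∈ G.H1mass μ, (G.energy p u : EReal)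

open Classical in
/-- `u ∈ H²_K(G)`, with first derivative `g` (its continuous representative on each closed edge) and
second derivative `h`: the sum of the outgoing derivatives at each vertex vanishes. A loop
contributes both of its ends. -/
structure IsH2KWith (G : MetricGraph V E) (u : G.Point → ℂ) (g h : E → ℝ → ℂ) : Prop where
  mem_H1 : u ∈ G.H1
  cont : ∀ e, ContinuousOn (g e) (Set.Icc 0 (G.len e))
  deriv₁ : ∀ e, IsWeakDeriv (G.len e) (restr u e) (g e)
  deriv₂ : ∀ e, IsWeakDeriv (G.len e) (g e) (h e)
  kirchhoff : ∀ v : V, (∑ e with G.src e = v, g e 0) + (∑ e with G.tgt e = v, -g e (G.len e)) = 0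

/-- `u ∈ H²_K(G)` solves `u'' + |u|^(p-2) u - lam u = 0` on `G` for some real `lam`. -/
def IsStationaryState (G : MetricGraph V E) (p : ℝ) (u : G.Point → ℂ) : Prop :=
  ∃ lam : ℝ, ∃ g h : E → ℝ → ℂ, G.IsH2KWith u g h ∧
    ∀ e, ∀ᵐ t ∂(volume.restrict (Set.Ioo 0 (G.len e))),
      h e t + ((‖restr u e t‖ ^ (p - 2) : ℝ) : ℂ) * restr u e t - (lam : ℂ) * restr u e t = 0

/-- `u` is a ground state of mass `μ`: a stationary state in `H¹_μ(G)` which globally minimizes the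
energy on `H¹_μ(G)`. -/
structure IsGroundState (G : MetricGraph V E) (p μ : ℝ) (u : G.Point → ℂ) : Prop where
  mem : u ∈ G.H1mass μ
  stationary : G.IsStationaryState p u
  energy_eq : (G.energy p u : EReal) = G.groundLevel p μ

/-- The constant function `κ_μ = √(μ / |G|)`. -/
def kappa (G : MetricGraph V E) (μ : ℝ) : G.Point → ℂ :=
  fun _ => ((√(μ / G.length) : ℝ) : ℂ)

end MetricGraph

end

/-! Write `D` for `‖u'‖₂²`, `ℓ` for the total length and `m = √(μ/ℓ)`. Constants have no kinetic
energy, so minimality amounts to `∫ |u|^p ≤ ℓ m^p + (p/2) D` for every `u` of mass `μ`. A threshold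
`d`, depending only on the graph and `p`, separates two regimes.

If `D ≤ d`, connectedness bounds the oscillation of `u` by `K √D` (`exists_norm_sub_le`), so `|u|`
stays within `K √D` of its quadratic mean `m`. Expand `|u|^p` around `m` as a function of `|u|²`
(`rpow_sub_rpow_le_taylor`): the linear term integrates to zero because the mass is fixed, and the
quadratic remainder is at most `(p/2) D` once `|u|` and `m` are small.

If `D ≥ d`, a Gagliardo–Nirenberg bound `|u|⁴ ≤ 16 M D` (`norm_restr_pow_four_le`) and `|u|^p ≤ (1 +
|u|⁴) |u|²`, where `2 < p ≤ 6` enters, give `∫ |u|^p ≤ (1 + 16 M D) μ`, which is below `D` for small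
mass. -/

/-! ### Smooth steps as test functions -/

/-- A smooth monotone function that vanishes on `(-∞, x]` and equals `1` on `[x + ε, ∞)`. -/
noncomputable def smoothStep (ε x t : ℝ) : ℝ := Real.smoothTransition ((t - x) / ε)

theorem contDiff_smoothStep (ε x : ℝ) : ContDiff ℝ ∞ (smoothStep ε x) :=
  (Real.smoothTransition.contDiff (n := ⊤)).comp (by fun_prop)

theorem differentiable_smoothStep (ε x : ℝ) : Differentiable ℝ (smoothStep ε x) :=
  (contDiff_smoothStep ε x).differentiable (by simp)

theorem continuous_deriv_smoothStep (ε x : ℝ) : Continuous (deriv (smoothStep ε x)) :=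
  (contDiff_smoothStep ε x).continuous_deriv (by simp)

theorem smoothStep_eq_zero {ε x t : ℝ} (hε : 0 < ε) (h : t ≤ x) : smoothStep ε x t = 0 :=
  Real.smoothTransition.zero_of_nonpos (div_nonpos_of_nonpos_of_nonneg (by linarith) hε.le)

theorem smoothStep_eq_one {ε x t : ℝ} (hε : 0 < ε) (h : x + ε ≤ t) : smoothStep ε x t = 1 :=
  Real.smoothTransition.one_of_one_le (by rw [le_div_iff₀ hε]; linarith)

theorem monotone_smoothStep {ε : ℝ} (hε : 0 < ε) (x : ℝ) : Monotone (smoothStep ε x) :=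
  fun s t h => Real.smoothTransition.monotone (by gcongr)

theorem smoothStep_antitone_left {ε : ℝ} (hε : 0 < ε) {x y : ℝ} (h : x ≤ y) (t : ℝ) :
    smoothStep ε y t ≤ smoothStep ε x t :=
  Real.smoothTransition.monotone (by gcongr)

theorem deriv_smoothStep_nonneg {ε : ℝ} (hε : 0 < ε) (x t : ℝ) : 0 ≤ deriv (smoothStep ε x) t :=
  (monotone_smoothStep hε x).deriv_nonneg

theorem deriv_smoothStep_eq_zero {ε x t : ℝ} (hε : 0 < ε) (h : t < x ∨ x + ε < t) :
    deriv (smoothStep ε x) t = 0 := by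
  rcases h with h | h
  · have : smoothStep ε x =ᶠ[nhds t] fun _ => 0 := by
      filter_upwards [eventually_lt_nhds h] with s hs using smoothStep_eq_zero hε hs.le
    rw [this.deriv_eq, deriv_const]
  · have : smoothStep ε x =ᶠ[nhds t] fun _ => 1 := by
      filter_upwards [eventually_gt_nhds h] with s hs using smoothStep_eq_one hε hs.le
    rw [this.deriv_eq, deriv_const]

theorem integral_Ioo_deriv_of_contDiff {l : ℝ} (hl : 0 ≤ l) {φ : ℝ → ℝ} (hφ : ContDiff ℝ ∞ φ) :
    ∫ t in Set.Ioo 0 l, deriv φ t = φ l - φ 0 := by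
  rw [← integral_Ioc_eq_integral_Ioo, ← intervalIntegral.integral_of_le hl]
  exact intervalIntegral.integral_deriv_eq_sub
    (fun x _ => (hφ.differentiable (by simp)).differentiableAt)
    ((hφ.continuous_deriv (by simp)).intervalIntegrable _ _)

theorem Continuous.integrableOn_Ioo {F : Type*} [NormedAddCommGroup F] {f : ℝ → F}
    (hf : Continuous f) (a b : ℝ) : IntegrableOn f (Set.Ioo a b) :=
  hf.integrableOn_Icc.mono_set Set.Ioo_subset_Icc_self

/-- The derivatives of steep smooth steps at `x` form an approximation of the Dirac mass at `x`. -/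
theorem norm_integral_deriv_smoothStep_smul_sub_le {l ε x η : ℝ} {f : ℝ → ℂ} (hf : Continuous f)
    (hε : 0 < ε) (hx : 0 ≤ x) (hxl : x + ε ≤ l)
    (hη : ∀ t, x ≤ t → t ≤ x + ε → ‖f t - f x‖ ≤ η) :
    ‖(∫ t in Set.Ioo 0 l, deriv (smoothStep ε x) t • f t) - f x‖ ≤ η := by
  have hc := continuous_deriv_smoothStep ε x
  have hint : ∫ t in Set.Ioo 0 l, deriv (smoothStep ε x) t = 1 := by
    rw [integral_Ioo_deriv_of_contDiff (by linarith) (contDiff_smoothStep ε x),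
      smoothStep_eq_one hε hxl, smoothStep_eq_zero hε hx, sub_zero]
  have hfx : f x = ∫ t in Set.Ioo 0 l, deriv (smoothStep ε x) t • f x := by
    rw [integral_smul_const, hint, one_smul]
  have hsub : (∫ t in Set.Ioo 0 l, deriv (smoothStep ε x) t • f t) - f x
      = ∫ t in Set.Ioo 0 l, deriv (smoothStep ε x) t • (f t - f x) := by
    conv_lhs => rw [hfx]
    rw [← integral_sub ((hc.fun_smul hf).integrableOn_Ioo _ _)
      ((hc.fun_smul continuous_const).integrableOn_Ioo _ _)]
    simp_rw [smul_sub]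
  rw [hsub]
  calc _ ≤ ∫ t in Set.Ioo 0 l, deriv (smoothStep ε x) t * η := by
        refine norm_integral_le_of_norm_le ((hc.mul continuous_const).integrableOn_Ioo _ _)
          (Filter.Eventually.of_forall fun t => ?_)
        rw [norm_smul, Real.norm_of_nonneg (deriv_smoothStep_nonneg hε x t)]
        by_cases ht : x ≤ t ∧ t ≤ x + ε
        · exact mul_le_mul_of_nonneg_left (hη t ht.1 ht.2) (deriv_smoothStep_nonneg hε x t)
        · rw [deriv_smoothStep_eq_zero hε (by rw [not_and_or, not_le, not_le] at ht; exact ht)]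
          simp
    _ = η := by rw [integral_mul_const, hint, one_mul]

/-- The Cauchy–Schwarz inequality against a function with values in `[0, 1]`. -/
theorem norm_integral_smul_le_sqrt {l a b : ℝ} {g : ℝ → ℂ} {φ : ℝ → ℝ} (hab : a ≤ b)
    (hg : MemLp g 2 (volume.restrict (Set.Ioo 0 l))) (hφc : Continuous φ)
    (h0 : ∀ t, 0 ≤ φ t) (h1 : ∀ t, φ t ≤ 1) (hsupp : ∀ t, t ∉ Set.Icc a b → φ t = 0) :
    ‖∫ t in Set.Ioo 0 l, φ t • g t‖ ≤ √((b - a) * ∫ t in Set.Ioo 0 l, ‖g t‖ ^ 2) := by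
  have hφ2 : ∫ t in Set.Ioo 0 l, φ t ^ 2 ≤ b - a := by
    calc ∫ t in Set.Ioo 0 l, φ t ^ 2
        ≤ ∫ t in Set.Ioo 0 l, (Set.Icc a b).indicator (fun _ => (1 : ℝ)) t := by
          refine integral_mono ((hφc.pow 2).integrableOn_Ioo _ _) ?_ fun t => ?_
          · exact (integrable_const _).indicator measurableSet_Icc
          · by_cases ht : t ∈ Set.Icc a b
            · rw [Set.indicator_of_mem ht]; exact pow_le_one₀ (h0 t) (h1 t)
            · simp [ht, hsupp t ht]
      _ ≤ ∫ t, (Set.Icc a b).indicator (fun _ => (1 : ℝ)) t := by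
          refine setIntegral_le_integral ?_ (Filter.Eventually.of_forall fun t => ?_)
          · exact (integrable_indicator_iff measurableSet_Icc).2
              (continuous_const.integrableOn_Icc)
          · exact Set.indicator_nonneg (fun _ _ => zero_le_one) t
      _ = b - a := by
          rw [integral_indicator measurableSet_Icc]
          simp [hab]
  have hmφ : MemLp φ (ENNReal.ofReal 2) (volume.restrict (Set.Ioo 0 l)) := by
    refine MemLp.of_bound hφc.aestronglyMeasurable 1 (Filter.Eventually.of_forall fun t => ?_)
    rw [Real.norm_of_nonneg (h0 t)]; exact h1 t
  have hmg : MemLp (fun t => ‖g t‖) (ENNReal.ofReal 2) (volume.restrict (Set.Ioo 0 l)) := by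
    simpa using hg.norm
  have hcs := integral_mul_le_Lp_mul_Lq_of_nonneg Real.HolderConjugate.two_two
    (Filter.Eventually.of_forall h0) (Filter.Eventually.of_forall fun t => norm_nonneg (g t))
    hmφ hmg
  simp only [Real.rpow_two, ← Real.sqrt_eq_rpow] at hcs
  calc ‖∫ t in Set.Ioo 0 l, φ t • g t‖ ≤ ∫ t in Set.Ioo 0 l, ‖φ t • g t‖ :=
        norm_integral_le_integral_norm _
    _ = ∫ t in Set.Ioo 0 l, φ t * ‖g t‖ := by
        simp_rw [norm_smul, fun t => Real.norm_of_nonneg (h0 t)]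
    _ ≤ _ := hcs
    _ ≤ √(b - a) * √(∫ t in Set.Ioo 0 l, ‖g t‖ ^ 2) := by gcongr
    _ = _ := (Real.sqrt_mul (by linarith) _).symm

/-! ### Hölder and Sobolev estimates on one segment -/

/-- Test the weak derivative with the difference of steep steps at `x` and `y`: its derivative is
nearly `δ_x - δ_y`, and the function itself is a bump with values in `[0, 1]`, so Cauchy–Schwarz
applies. The `η` terms absorb the two approximation errors and the overhang `ε` beyond `y`. -/
theorem IsWeakDeriv.norm_sub_le_add {l : ℝ} {f g : ℝ → ℂ} (hf : Continuous f)
    (h : IsWeakDeriv l f g) {x y η : ℝ} (hx : 0 < x) (hxy : x ≤ y) (hy : y < l) (hη : 0 < η) :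
    ‖f y - f x‖ ≤ 2 * η + √((y + η - x) * ∫ t in Set.Ioo 0 l, ‖g t‖ ^ 2) := by
  obtain ⟨δx, hδx, hx'⟩ := Metric.continuous_iff.1 hf x η hη
  obtain ⟨δy, hδy, hy'⟩ := Metric.continuous_iff.1 hf y η hη
  obtain ⟨ε, hε, hεb⟩ : ∃ ε, 0 < ε ∧ ε < min (min δx δy) (min η (l - y)) :=
    exists_between (by simp only [lt_min_iff]; exact ⟨⟨hδx, hδy⟩, hη, by linarith⟩)
  simp only [lt_min_iff] at hεb
  obtain ⟨⟨hεx, hεy⟩, hεη, hεl⟩ := hεb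
  set φ : ℝ → ℝ := fun t => smoothStep ε x t - smoothStep ε y t with hφ
  have hφs : ContDiff ℝ ∞ φ := (contDiff_smoothStep ε x).sub (contDiff_smoothStep ε y)
  have hzero : ∀ t, t ∉ Set.Icc x (y + ε) → φ t = 0 := by
    intro t ht
    rw [Set.mem_Icc, not_and_or, not_le, not_le] at ht
    rcases ht with ht | ht
    · simp [hφ, smoothStep_eq_zero hε ht.le, smoothStep_eq_zero hε (ht.le.trans hxy)]
    · simp [hφ, smoothStep_eq_one hε ht.le,
        smoothStep_eq_one hε (by linarith : x + ε ≤ t)]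
  have htsupp : tsupport φ ⊆ Set.Icc x (y + ε) :=
    closure_minimal (Function.support_subset_iff'.2 hzero) isClosed_Icc
  have hw := h.2 φ hφs (HasCompactSupport.of_support_subset_isCompact isCompact_Icc
    (subset_closure.trans htsupp))
    (htsupp.trans fun t ht => ⟨hx.trans_le ht.1, by linarith [ht.2]⟩)
  have hderiv : ∀ t, deriv φ t = deriv (smoothStep ε x) t - deriv (smoothStep ε y) t := fun t =>
    deriv_sub (differentiable_smoothStep ε x t) (differentiable_smoothStep ε y t)
  simp_rw [hderiv, sub_smul] at hw
  rw [integral_sub (((continuous_deriv_smoothStep ε x).fun_smul hf).integrableOn_Ioo _ _)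
    (((continuous_deriv_smoothStep ε y).fun_smul hf).integrableOn_Ioo _ _)] at hw
  have bx := norm_integral_deriv_smoothStep_smul_sub_le (l := l) (η := η) hf hε hx.le
    (by linarith) fun t h1 h2 => by
      rw [← dist_eq_norm]
      exact (hx' t (by rw [Real.dist_eq, abs_of_nonneg] <;> linarith)).le
  have by' := norm_integral_deriv_smoothStep_smul_sub_le (l := l) (η := η) hf hε
    (hx.le.trans hxy) (by linarith) fun t h1 h2 => by
      rw [← dist_eq_norm]
      exact (hy' t (by rw [Real.dist_eq, abs_of_nonneg] <;> linarith)).le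
  have bφ := norm_integral_smul_le_sqrt (l := l) (by linarith : x ≤ y + ε) h.1 hφs.continuous
    (fun t => sub_nonneg.2 (smoothStep_antitone_left hε hxy t))
    (fun t => (sub_le_self _ (Real.smoothTransition.nonneg _)).trans
      (Real.smoothTransition.le_one _)) hzero
  set A := ∫ t in Set.Ioo 0 l, deriv (smoothStep ε x) t • f t
  set B := ∫ t in Set.Ioo 0 l, deriv (smoothStep ε y) t • f t
  set C := ∫ t in Set.Ioo 0 l, φ t • g t
  have key : f y - f x = (A - f x) - (B - f y) + C := by
    have : C = -(A - B) := by rw [hw, neg_neg]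
    rw [this]; ring
  have hD : 0 ≤ ∫ t in Set.Ioo 0 l, ‖g t‖ ^ 2 := integral_nonneg fun t => by positivity
  calc ‖f y - f x‖ ≤ ‖A - f x‖ + ‖B - f y‖ + ‖C‖ := by
        rw [key]; exact (norm_add_le _ _).trans (by gcongr; exact norm_sub_le _ _)
    _ ≤ η + η + √((y + η - x) * ∫ t in Set.Ioo 0 l, ‖g t‖ ^ 2) := by
        gcongr
        exact bφ.trans (Real.sqrt_le_sqrt (by gcongr))
    _ = _ := by ring

/-- Functions in `H¹` of an interval are Hölder continuous of exponent `1 / 2`. -/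
theorem IsWeakDeriv.norm_sub_sq_le {l : ℝ} (hl : 0 < l) {f g : ℝ → ℂ} (hf : Continuous f)
    (h : IsWeakDeriv l f g) {x y : ℝ} (hx : x ∈ Set.Icc 0 l) (hy : y ∈ Set.Icc 0 l) :
    ‖f y - f x‖ ^ 2 ≤ |y - x| * ∫ t in Set.Ioo 0 l, ‖g t‖ ^ 2 := by
  set D := ∫ t in Set.Ioo 0 l, ‖g t‖ ^ 2
  have hD : 0 ≤ D := integral_nonneg fun t => by positivity
  have hlt : ∀ x y, 0 < x → x ≤ y → y < l → ‖f y - f x‖ ^ 2 ≤ |y - x| * D := by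
    intro x y hx hxy hy
    have hlim : Filter.Tendsto (fun η => 2 * η + √((y + η - x) * D)) (nhdsWithin 0 (Set.Ioi 0))
        (nhds (2 * 0 + √((y + 0 - x) * D))) :=
      Filter.Tendsto.mono_left (Continuous.tendsto (by fun_prop) 0) nhdsWithin_le_nhds
    have hle : ‖f y - f x‖ ≤ 2 * 0 + √((y + 0 - x) * D) :=
      ge_of_tendsto hlim (by
        filter_upwards [self_mem_nhdsWithin] with η hη using h.norm_sub_le_add hf hx hxy hy hη)
    rw [mul_zero, zero_add, add_zero] at hle
    rw [abs_of_nonneg (by linarith)]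
    exact (Real.le_sqrt (norm_nonneg _) (mul_nonneg (by linarith) hD)).1 hle
  -- Test functions only reach the open interval; continuity carries the bound to the closed square.
  have hsub : Set.Ioo 0 l ×ˢ Set.Ioo 0 l ⊆
      {q : ℝ × ℝ | ‖f q.2 - f q.1‖ ^ 2 ≤ |q.2 - q.1| * D} := by
    rintro ⟨a, b⟩ ⟨ha, hb⟩
    rcases le_total a b with hab | hab
    · exact hlt a b ha.1 hab hb.2
    · have := hlt b a hb.1 hab ha.2
      rwa [norm_sub_rev, abs_sub_comm] at this
  have hcl : IsClosed {q : ℝ × ℝ | ‖f q.2 - f q.1‖ ^ 2 ≤ |q.2 - q.1| * D} :=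
    isClosed_le (by fun_prop) (by fun_prop)
  have := closure_minimal hsub hcl
  rw [closure_prod_eq, closure_Ioo hl.ne] at this
  exact this (⟨hx, hy⟩ : (x, y) ∈ Set.Icc 0 l ×ˢ Set.Icc 0 l)

/-- A local Sobolev inequality at scale `r`. -/
theorem IsWeakDeriv.norm_sq_le {l : ℝ} {f g : ℝ → ℂ} (hf : Continuous f)
    (h : IsWeakDeriv l f g) {x r : ℝ} (hx : x ∈ Set.Icc 0 l) (hr : 0 < r) (hrl : r ≤ l) :
    ‖f x‖ ^ 2 ≤ 2 * r * (∫ t in Set.Ioo 0 l, ‖g t‖ ^ 2)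
      + 2 / r * ∫ t in Set.Ioo 0 l, ‖f t‖ ^ 2 := by
  set D := ∫ t in Set.Ioo 0 l, ‖g t‖ ^ 2
  have hD : 0 ≤ D := integral_nonneg fun t => by positivity
  have hc : Continuous fun t => ‖f t‖ ^ 2 := by fun_prop
  -- A window of length `r` inside `[0, l]` containing `x`; the Hölder bound is averaged over it.
  obtain ⟨a, ha0, hal, hax, hxa⟩ : ∃ a, 0 ≤ a ∧ a + r ≤ l ∧ a ≤ x ∧ x ≤ a + r := by
    rcases le_total x (l - r) with hxl | hxl
    · exact ⟨x, hx.1, by linarith, le_rfl, by linarith⟩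
    · exact ⟨l - r, by linarith, by linarith, hxl, by linarith [hx.2]⟩
  have hsub : Set.Ioo a (a + r) ⊆ Set.Ioo 0 l := Set.Ioo_subset_Ioo ha0 hal
  have hpt : ∀ t ∈ Set.Ioo a (a + r), ‖f x‖ ^ 2 ≤ 2 * (r * D) + 2 * ‖f t‖ ^ 2 := by
    intro t ht
    have h1 := h.norm_sub_sq_le (hr.trans_le hrl) hf (Set.Ioo_subset_Icc_self (hsub ht)) hx
    have h2 : |x - t| * D ≤ r * D := by
      gcongr
      rw [abs_le]; constructor <;> linarith [ht.1, ht.2]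
    have h3 : ‖f x‖ ≤ ‖f x - f t‖ + ‖f t‖ := norm_le_norm_sub_add _ _
    have h4 : ‖f x‖ ^ 2 ≤ (‖f x - f t‖ + ‖f t‖) ^ 2 := by gcongr
    nlinarith [sq_nonneg (‖f x - f t‖ - ‖f t‖)]
  have hint : r * ‖f x‖ ^ 2 ≤ r * (2 * (r * D)) + 2 * ∫ t in Set.Ioo a (a + r), ‖f t‖ ^ 2 := by
    have := setIntegral_mono_on (μ := volume) (continuous_const.integrableOn_Ioo a (a + r))
      ((continuous_const.fun_add (continuous_const.fun_mul hc)).integrableOn_Ioo a (a + r))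
      measurableSet_Ioo hpt
    rw [integral_add (continuous_const.integrableOn_Ioo _ _)
      ((continuous_const.fun_mul hc).integrableOn_Ioo _ _),
      integral_const_mul (2 : ℝ) fun t => ‖f t‖ ^ 2] at this
    simp only [integral_const, MeasurableSet.univ, measureReal_restrict_apply, Set.univ_inter,
      Real.volume_real_Ioo_of_le (by linarith : a ≤ a + r), add_sub_cancel_left,
      smul_eq_mul] at this
    exact this
  have hmono : ∫ t in Set.Ioo a (a + r), ‖f t‖ ^ 2 ≤ ∫ t in Set.Ioo 0 l, ‖f t‖ ^ 2 :=
    setIntegral_mono_set (hc.integrableOn_Ioo _ _)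
      (Filter.Eventually.of_forall fun t => by positivity) hsub.eventuallyLE
  have : r * ‖f x‖ ^ 2 ≤ r * (2 * r * D + 2 / r * ∫ t in Set.Ioo 0 l, ‖f t‖ ^ 2) := by
    rw [mul_add, ← mul_assoc r (2 / r), mul_div_cancel₀ _ hr.ne']
    nlinarith
  exact le_of_mul_le_mul_left this hr

/-! ### Weak derivatives of constants -/

theorem isWeakDeriv_const {l : ℝ} (hl : 0 ≤ l) (c : ℂ) :
    IsWeakDeriv l (fun _ => c) fun _ => 0 := by
  refine ⟨MemLp.zero', fun φ hφ _ hsupp => ?_⟩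
  have h0 : φ 0 = 0 := image_eq_zero_of_notMem_tsupport fun h => lt_irrefl _ (hsupp h).1
  have h1 : φ l = 0 := image_eq_zero_of_notMem_tsupport fun h => lt_irrefl _ (hsupp h).2
  rw [integral_smul_const, integral_Ioo_deriv_of_contDiff hl hφ, h0, h1]
  simp

/-- `weakDeriv` is an arbitrary choice among weak derivatives, so its vanishing for constants rests
on the fundamental lemma of the calculus of variations. -/
theorem IsWeakDeriv.ae_eq_zero_of_const {l : ℝ} (hl : 0 ≤ l) {c : ℂ} {g : ℝ → ℂ}
    (h : IsWeakDeriv l (fun _ => c) g) : ∀ᵐ t ∂volume.restrict (Set.Ioo 0 l), g t = 0 := by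
  rw [ae_restrict_iff' measurableSet_Ioo]
  have hint : IntegrableOn g (Set.Ioo 0 l) := h.1.integrable (by norm_num)
  refine isOpen_Ioo.ae_eq_zero_of_integral_contDiff_smul_eq_zero hint.locallyIntegrableOn
    fun φ hφ hc hsupp => ?_
  have h1 := h.2 φ hφ hc hsupp
  rw [(isWeakDeriv_const hl c).2 φ hφ hc hsupp] at h1
  simp only [smul_zero, integral_zero, neg_zero] at h1
  rw [← setIntegral_eq_integral_of_forall_compl_eq_zero (s := Set.Ioo 0 l), ← neg_eq_zero, ← h1]
  intro t ht
  rw [image_eq_zero_of_notMem_tsupport fun h => ht (hsupp h), zero_smul]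

theorem isWeakDeriv_weakDeriv {l : ℝ} {f : ℝ → ℂ} (h : MemSobolev1 l f) :
    IsWeakDeriv l f (weakDeriv l f) := by
  rw [weakDeriv, dif_pos h.2]
  exact h.2.choose_spec

/-! ### Inequalities for real powers -/

/-- By homogeneity only `t = b / a ∈ [0, 1]` matters: `1 - t^q ≤ 1 - t⁴ ≤ 4 (1 - t)` by Bernoulli
and `1 - t² ≤ 2 (1 - t)`, whence the factor 8. -/
theorem rpow_sub_rpow_mul_sq_sub_sq_le {a b q : ℝ} (hb : 0 ≤ b) (hba : b ≤ a) (hq : q ≤ 4) :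
    (a ^ q - b ^ q) * (a ^ 2 - b ^ 2) ≤ 8 * a ^ q * (a - b) ^ 2 := by
  rcases (hb.trans hba).eq_or_lt with ha | ha
  · have : b = a := le_antisymm hba (ha ▸ hb)
    simp [this]
  set t := b / a with ht
  have ht0 : 0 ≤ t := by positivity
  have ht1 : t ≤ 1 := (div_le_one ha).2 hba
  have hbt : b = a * t := by rw [ht]; field_simp
  have htq : t ^ 4 ≤ t ^ q := by
    have := Real.rpow_le_rpow_of_exponent_ge_of_imp ht0 ht1 hq (fun _ h => by
      norm_num at h)
    simpa using mod_cast this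
  have haq : 0 < a ^ q := Real.rpow_pos_of_pos ha q
  have h4 : 1 - t ^ q ≤ 4 * (1 - t) := by
    have := one_add_mul_le_pow (show (-2 : ℝ) ≤ t - 1 by linarith) 4
    rw [add_sub_cancel] at this
    push_cast at this
    linarith
  have h2 : 1 - t ^ 2 ≤ 2 * (1 - t) := by nlinarith
  have h2' : 0 ≤ 1 - t ^ 2 := by nlinarith
  rw [hbt, Real.mul_rpow ha.le ht0]
  calc (a ^ q - a ^ q * t ^ q) * (a ^ 2 - (a * t) ^ 2)
      = a ^ q * a ^ 2 * ((1 - t ^ q) * (1 - t ^ 2)) := by ring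
    _ ≤ a ^ q * a ^ 2 * ((4 * (1 - t)) * (2 * (1 - t))) := by gcongr
    _ = 8 * a ^ q * (a - a * t) ^ 2 := by ring

/-- Convexity of `s ↦ s^(p/2)`: its tangent at `a²` lies below the graph at `m²`. Moving the slope
from `a` to `m` then produces the quadratic remainder of the Taylor estimate. -/
theorem rpow_sub_rpow_le_mul_sq_sub_sq {a m p : ℝ} (ha : 0 ≤ a) (hm : 0 ≤ m) (hp : 2 < p) :
    a ^ p - m ^ p ≤ p / 2 * a ^ (p - 2) * (a ^ 2 - m ^ 2) := by
  rcases ha.eq_or_lt with rfl | ha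
  · rw [Real.zero_rpow (by linarith), Real.zero_rpow (by linarith)]
    have := Real.rpow_nonneg hm p
    linarith
  have hB := one_add_mul_self_le_rpow_one_add
    (show -1 ≤ m ^ 2 / a ^ 2 - 1 by linarith [div_nonneg (sq_nonneg m) (sq_nonneg a)])
    (show 1 ≤ p / 2 by linarith)
  have hpow : (1 + (m ^ 2 / a ^ 2 - 1)) ^ (p / 2) = m ^ p / a ^ p := by
    rw [add_sub_cancel, ← div_pow, ← Real.rpow_natCast, ← Real.rpow_mul (by positivity),
      Real.div_rpow hm ha.le]
    congr 2 <;> push_cast <;> ring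
  have hap : 0 < a ^ p := Real.rpow_pos_of_pos ha p
  have hap2 : a ^ p = a ^ (p - 2) * a ^ 2 := by
    rw [← Real.rpow_natCast, ← Real.rpow_add ha]; norm_num
  rw [hpow, le_div_iff₀ hap] at hB
  have : (1 + p / 2 * (m ^ 2 / a ^ 2 - 1)) * a ^ p
      = a ^ p + p / 2 * a ^ (p - 2) * (m ^ 2 - a ^ 2) := by
    rw [hap2]; field_simp
  rw [this] at hB
  linarith

/-- A second order Taylor estimate for `x ↦ x ^ p` as a function of `x ^ 2`. -/
theorem rpow_sub_rpow_le_taylor {a m p : ℝ} (ha : 0 ≤ a) (hm : 0 ≤ m) (hp : 2 < p) (hp' : p ≤ 6) :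
    a ^ p - m ^ p ≤ p / 2 * m ^ (p - 2) * (a ^ 2 - m ^ 2)
      + 4 * p * max a m ^ (p - 2) * (a - m) ^ 2 := by
  have h1 := rpow_sub_rpow_le_mul_sq_sub_sq ha hm hp
  have h2 : (a ^ (p - 2) - m ^ (p - 2)) * (a ^ 2 - m ^ 2) ≤ 8 * max a m ^ (p - 2) * (a - m) ^ 2 := by
    rcases le_total m a with h | h
    · rw [max_eq_left h]
      exact rpow_sub_rpow_mul_sq_sub_sq_le hm h (by linarith)
    · rw [max_eq_right h]
      have := rpow_sub_rpow_mul_sq_sub_sq_le ha h (q := p - 2) (by linarith)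
      nlinarith
  nlinarith

theorem rpow_le_one_add_pow_four_mul_sq {a p : ℝ} (ha : 0 ≤ a) (hp : 2 < p) (hp' : p ≤ 6) :
    a ^ p ≤ (1 + a ^ 4) * a ^ 2 := by
  rcases le_total a 1 with h | h
  · have h1 : a ^ p ≤ a ^ 2 := by
      have := Real.rpow_le_rpow_of_exponent_ge_of_imp ha h hp.le (fun _ h => by linarith)
      simpa using mod_cast this
    nlinarith [pow_nonneg ha 6]
  · have h1 : a ^ p ≤ a ^ 6 := by
      have := Real.rpow_le_rpow_of_exponent_le h hp'
      simpa using mod_cast this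
    nlinarith [sq_nonneg a]

/-! ### Points and integrals on the graph -/

namespace MetricGraph

section Edgewise

variable {V E : Type*} {G : MetricGraph V E}

theorem restr_of_mem (u : G.Point → ℂ) (e : E) {t : ℝ} (ht : t ∈ Set.Icc 0 (G.len e)) :
    restr u e t = u (G.pt e ⟨t, ht⟩) :=
  Set.IccExtend_of_mem _ _ ht

theorem continuous_restr {u : G.Point → ℂ} (hu : Continuous u) (e : E) : Continuous (restr u e) :=
  Continuous.Icc_extend' (hu.comp (continuous_quot_mk.comp continuous_sigmaMk))

theorem pt_eq_of_atVertex {x y : G.Seg} {v : V} (hx : G.AtVertex x v) (hy : G.AtVertex y v) :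
    G.pt x.1 x.2 = G.pt y.1 y.2 :=
  Quot.sound ⟨v, hx, hy⟩

/-- Connectedness excludes isolated vertices as soon as there is an edge. This supplies the
intermediate point when paths are concatenated. -/
theorem exists_atVertex [Nonempty E] (G : MetricGraph V E) (v : V) : ∃ x, G.AtVertex x v := by
  let head (e : E) : G.Seg := ⟨e, 0, le_rfl, (G.len_pos e).le⟩
  let tail (e : E) : G.Seg := ⟨e, G.len e, (G.len_pos e).le, le_rfl⟩
  have hiff : ∀ a b, Relation.EqvGen (fun a b => ∃ e, G.src e = a ∧ G.tgt e = b) a b →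
      ((∃ x, G.AtVertex x a) ↔ ∃ x, G.AtVertex x b) := by
    intro a b hab
    induction hab with
    | rel a b h =>
      obtain ⟨e, rfl, rfl⟩ := h
      exact iff_of_true ⟨head e, .inl ⟨rfl, rfl⟩⟩ ⟨tail e, .inr ⟨rfl, rfl⟩⟩
    | refl => rfl
    | symm _ _ _ ih => exact ih.symm
    | trans _ _ _ _ _ ih₁ ih₂ => exact ih₁.trans ih₂
  obtain ⟨e⟩ := ‹Nonempty E›
  exact (hiff _ _ (G.connected v (G.src e))).2 ⟨head e, .inl ⟨rfl, rfl⟩⟩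

end Edgewise

variable {V E : Type*} [Fintype E] {G : MetricGraph V E}

theorem integral_nonneg' {f : E → ℝ → ℝ} (hf : ∀ e t, 0 ≤ f e t) : 0 ≤ G.integral f :=
  Finset.sum_nonneg fun e _ => integral_nonneg (hf e)

theorem setIntegral_le_integral {f : E → ℝ → ℝ} (hf : ∀ e t, 0 ≤ f e t) (e : E) :
    ∫ t in Set.Ioo 0 (G.len e), f e t ≤ G.integral f :=
  Finset.single_le_sum (f := fun e => ∫ t in Set.Ioo 0 (G.len e), f e t)
    (fun e _ => integral_nonneg (hf e)) (Finset.mem_univ e)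

theorem integral_mono_of_continuous {f g : E → ℝ → ℝ} (hf : ∀ e, Continuous (f e))
    (hg : ∀ e, Continuous (g e)) (h : ∀ e, ∀ t ∈ Set.Icc 0 (G.len e), f e t ≤ g e t) :
    G.integral f ≤ G.integral g :=
  Finset.sum_le_sum fun e _ => setIntegral_mono_on ((hf e).integrableOn_Ioo _ _)
    ((hg e).integrableOn_Ioo _ _) measurableSet_Ioo
    fun t ht => h e t (Set.Ioo_subset_Icc_self ht)

theorem integral_const (G : MetricGraph V E) (c : ℝ) : G.integral (fun _ _ => c) = G.length * c := by
  simp [MetricGraph.integral, length, Finset.sum_mul, fun e => (G.len_pos e).le]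

theorem integral_const_add_mul {f : E → ℝ → ℝ} (hf : ∀ e, Continuous (f e)) (c d : ℝ) :
    G.integral (fun e t => c + d * f e t) = G.length * c + d * G.integral f := by
  rw [← integral_const]
  simp only [MetricGraph.integral, Finset.mul_sum, ← Finset.sum_add_distrib]
  refine Finset.sum_congr rfl fun e _ => ?_
  rw [integral_add (continuous_const.integrableOn_Ioo _ _)
    ((continuous_const.fun_mul (hf e)).integrableOn_Ioo _ _), integral_const_mul d (f e)]

theorem length_pos [Nonempty E] (G : MetricGraph V E) : 0 < G.length :=
  Finset.sum_pos (fun e _ => G.len_pos e) Finset.univ_nonempty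

theorem len_le_length (e : E) : G.len e ≤ G.length :=
  Finset.single_le_sum (f := G.len) (fun e _ => (G.len_pos e).le) (Finset.mem_univ e)

/-! ### Oscillation and the Dirichlet integral -/

/-- The Dirichlet integral `‖u'‖₂²`. -/
noncomputable def dirichlet (G : MetricGraph V E) (u : G.Point → ℂ) : ℝ :=
  G.integral fun e t => ‖weakDeriv (G.len e) (restr u e) t‖ ^ 2

theorem dirichlet_nonneg (u : G.Point → ℂ) : 0 ≤ G.dirichlet u :=
  integral_nonneg' fun _ _ => by positivity

theorem norm_restr_sub_restr_le {u : G.Point → ℂ} (hu : u ∈ G.H1) (e : E) {s t : ℝ}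
    (hs : s ∈ Set.Icc 0 (G.len e)) (ht : t ∈ Set.Icc 0 (G.len e)) :
    ‖restr u e t - restr u e s‖ ≤ √G.length * √(G.dirichlet u) := by
  have hlen : 0 ≤ G.length := (G.len_pos e).le.trans (len_le_length e)
  rw [← Real.sqrt_mul hlen]
  refine Real.le_sqrt_of_sq_le (((isWeakDeriv_weakDeriv (hu.2 e)).norm_sub_sq_le (G.len_pos e)
    (continuous_restr hu.1 e) hs ht).trans ?_)
  have : |t - s| ≤ G.length := by
    refine le_trans ?_ (len_le_length e)
    rw [abs_le]; constructor <;> linarith [hs.1, hs.2, ht.1, ht.2]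
  have h1 : ∫ τ in Set.Ioo 0 (G.len e), ‖weakDeriv (G.len e) (restr u e) τ‖ ^ 2 ≤ G.dirichlet u :=
    setIntegral_le_integral (f := fun e t => ‖weakDeriv (G.len e) (restr u e) t‖ ^ 2)
      (fun _ _ => by positivity) e
  exact mul_le_mul this h1 (integral_nonneg fun _ => by positivity) hlen

theorem norm_pt_sub_pt_le {u : G.Point → ℂ} (hu : u ∈ G.H1) (e : E)
    (s t : Set.Icc 0 (G.len e)) :
    ‖u (G.pt e t) - u (G.pt e s)‖ ≤ √G.length * √(G.dirichlet u) := by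
  have := norm_restr_sub_restr_le hu e s.2 t.2
  rwa [restr_of_mem, restr_of_mem] at this

/-- Follow a chain of edges from `v` to `w`: each edge costs at most `√ℓ √D`, and glued endpoints
cost nothing. The constant depends on the chain, not on `u`. -/
theorem exists_norm_sub_le_of_atVertex [Nonempty E] (G : MetricGraph V E) (v w : V) :
    ∃ C, 0 ≤ C ∧ ∀ u ∈ G.H1, ∀ x y : G.Seg, G.AtVertex x v → G.AtVertex y w →
      ‖u (G.pt x.1 x.2) - u (G.pt y.1 y.2)‖ ≤ C * √(G.dirichlet u) := by
  induction G.connected v w with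
  | rel a b h =>
    obtain ⟨e, rfl, rfl⟩ := h
    refine ⟨√G.length, Real.sqrt_nonneg _, fun u hu x y hx hy => ?_⟩
    rw [pt_eq_of_atVertex hx (y := ⟨e, 0, le_rfl, (G.len_pos e).le⟩) (.inl ⟨rfl, rfl⟩),
      pt_eq_of_atVertex hy (y := ⟨e, G.len e, (G.len_pos e).le, le_rfl⟩) (.inr ⟨rfl, rfl⟩)]
    exact norm_pt_sub_pt_le hu e _ _
  | refl a =>
    refine ⟨0, le_rfl, fun u _ x y hx hy => ?_⟩
    rw [pt_eq_of_atVertex hx hy, sub_self, norm_zero, zero_mul]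
  | symm a b _ ih =>
    obtain ⟨C, hC, h⟩ := ih
    exact ⟨C, hC, fun u hu x y hx hy => by rw [norm_sub_rev]; exact h u hu y x hy hx⟩
  | trans a b c _ _ ih₁ ih₂ =>
    obtain ⟨C₁, hC₁, h₁⟩ := ih₁
    obtain ⟨C₂, hC₂, h₂⟩ := ih₂
    obtain ⟨z, hz⟩ := G.exists_atVertex b
    refine ⟨C₁ + C₂, add_nonneg hC₁ hC₂, fun u hu x y hx hy => ?_⟩
    rw [add_mul]
    exact (norm_sub_le_norm_sub_add_norm_sub _ (u (G.pt z.1 z.2)) _).trans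
      (add_le_add (h₁ u hu x z hx hz) (h₂ u hu z y hz hy))

/-- The oscillation of `u ∈ H¹(G)` is controlled by `‖u'‖₂`. -/
theorem exists_norm_sub_le [Nonempty E] (G : MetricGraph V E) :
    ∃ K, 0 < K ∧ ∀ u ∈ G.H1, ∀ e e', ∀ t ∈ Set.Icc 0 (G.len e), ∀ t' ∈ Set.Icc 0 (G.len e'),
      ‖restr u e t - restr u e' t'‖ ≤ K * √(G.dirichlet u) := by
  -- Indexing by pairs of edges makes the sum of constants finite; `V` carries no finiteness
  -- assumption.
  choose C hC h using fun q : E × E => G.exists_norm_sub_le_of_atVertex (G.src q.1) (G.src q.2)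
  have hL : 0 < √G.length := Real.sqrt_pos.2 G.length_pos
  refine ⟨√G.length + ∑ q, C q + √G.length,
    by linarith [Finset.sum_nonneg fun q (_ : q ∈ Finset.univ) => hC q],
    fun u hu e e' t ht t' ht' => ?_⟩
  have h0 : (0 : ℝ) ∈ Set.Icc 0 (G.len e) := ⟨le_rfl, (G.len_pos e).le⟩
  have h0' : (0 : ℝ) ∈ Set.Icc 0 (G.len e') := ⟨le_rfl, (G.len_pos e').le⟩
  have h1 := norm_restr_sub_restr_le hu e h0 ht
  have h2 := norm_restr_sub_restr_le hu e' ht' h0'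
  have h3 : ‖restr u e 0 - restr u e' 0‖ ≤ (∑ q, C q) * √(G.dirichlet u) := by
    rw [restr_of_mem u e h0, restr_of_mem u e' h0']
    refine (h (e, e') u hu ⟨e, 0, h0⟩ ⟨e', 0, h0'⟩ (.inl ⟨rfl, rfl⟩) (.inl ⟨rfl, rfl⟩)).trans ?_
    gcongr
    exact Finset.single_le_sum (fun q _ => hC q) (Finset.mem_univ (e, e'))
  have h4 := norm_sub_le_norm_sub_add_norm_sub (restr u e t) (restr u e 0) (restr u e' t')
  have h5 := norm_sub_le_norm_sub_add_norm_sub (restr u e 0) (restr u e' 0) (restr u e' t')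
  linarith

/-! ### The two bounds on the `p`-th power integral -/

/-- A function of small oscillation stays close to its quadratic mean. -/
theorem abs_sub_le_of_integral_sq [Nonempty E] {F : E → ℝ → ℝ} {m δ : ℝ}
    (hF : ∀ e, Continuous (F e)) (hF0 : ∀ e t, 0 ≤ F e t) (hm : 0 ≤ m)
    (hmean : G.integral (fun e t => F e t ^ 2) = G.length * m ^ 2)
    (hosc : ∀ e e', ∀ t ∈ Set.Icc 0 (G.len e), ∀ t' ∈ Set.Icc 0 (G.len e'),
      F e t - F e' t' ≤ δ) (e : E) {t : ℝ} (ht : t ∈ Set.Icc 0 (G.len e)) : |F e t - m| ≤ δ := by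
  have hL := G.length_pos
  have hc : ∀ e, Continuous fun t => F e t ^ 2 := fun e => (hF e).pow 2
  rw [abs_le]
  constructor
  -- A value below `m - δ` would force the whole function below `m`, contradicting the quadratic
  -- mean; the other half is symmetric.
  · by_contra! hlt
    have hδ : 0 ≤ δ := by simpa using hosc e e t ht t ht
    have hle : G.integral (fun e t => F e t ^ 2) ≤ G.integral fun _ _ => (F e t + δ) ^ 2 := by
      refine integral_mono_of_continuous hc (fun _ => continuous_const) fun e' t' ht' => ?_
      have := hosc e' e t' ht' t ht
      exact pow_le_pow_left₀ (hF0 _ _) (by linarith) 2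
    rw [hmean, integral_const] at hle
    have := le_of_mul_le_mul_left hle hL
    have h0 := hF0 e t
    nlinarith
  · by_contra! hlt
    have hle : G.integral (fun _ _ => (F e t - δ) ^ 2) ≤ G.integral (fun e t => F e t ^ 2) := by
      refine integral_mono_of_continuous (fun _ => continuous_const) hc fun e' t' ht' => ?_
      have := hosc e e' t ht t' ht'
      exact pow_le_pow_left₀ (by linarith) (by linarith) 2
    rw [hmean, integral_const] at hle
    have := le_of_mul_le_mul_left hle hL
    nlinarith

/-- The integrated Taylor estimate: its linear term in `F² - m²` cancels by `hmean`. -/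
theorem integral_rpow_le_of_abs_sub_le {F : E → ℝ → ℝ} {m δ B p : ℝ}
    (hp : 2 < p) (hp' : p ≤ 6) (hF : ∀ e, Continuous (F e)) (hF0 : ∀ e t, 0 ≤ F e t)
    (hm : 0 ≤ m) (hmean : G.integral (fun e t => F e t ^ 2) = G.length * m ^ 2)
    (hδ : ∀ e, ∀ t ∈ Set.Icc 0 (G.len e), |F e t - m| ≤ δ) (hδ0 : 0 ≤ δ) (hB : m + δ ≤ B) :
    G.integral (fun e t => F e t ^ p)
      ≤ G.length * m ^ p + G.length * (4 * p * B ^ (p - 2) * δ ^ 2) := by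
  have hc : ∀ e, Continuous fun t => F e t ^ 2 := fun e => (hF e).pow 2
  calc G.integral (fun e t => F e t ^ p)
      ≤ G.integral fun e t => (m ^ p - p / 2 * m ^ (p - 2) * m ^ 2
          + 4 * p * B ^ (p - 2) * δ ^ 2) + p / 2 * m ^ (p - 2) * F e t ^ 2 := by
        refine integral_mono_of_continuous
          (fun e => (hF e).rpow_const fun _ => .inr (by linarith))
          (fun e => by fun_prop) fun e t ht => ?_
        have h1 := rpow_sub_rpow_le_taylor (hF0 e t) hm hp hp'
        have h2 := abs_le.1 (hδ e t ht)
        have h3 : max (F e t) m ^ (p - 2) ≤ B ^ (p - 2) :=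
          Real.rpow_le_rpow (le_max_of_le_right hm) (max_le (by linarith) (by linarith))
            (by linarith)
        have h4 : (F e t - m) ^ 2 ≤ δ ^ 2 := sq_le_sq' h2.1 h2.2
        have h5 : 4 * p * max (F e t) m ^ (p - 2) * (F e t - m) ^ 2
            ≤ 4 * p * B ^ (p - 2) * δ ^ 2 := by
          have : 0 ≤ B ^ (p - 2) := Real.rpow_nonneg (by linarith) _
          gcongr
        linarith
    _ = _ := by rw [integral_const_add_mul hc, hmean]; ring

/-- The scale `r = √(M / D)` balances the two terms of the local Sobolev inequality; `hlen` says
that it fits in every edge. -/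
theorem norm_restr_pow_four_le {u : G.Point → ℂ} (hu : u ∈ G.H1) {M : ℝ} (hM : 0 < M)
    (hmass : G.mass u ≤ M) (hD : 0 < G.dirichlet u)
    (hlen : ∀ e, M ≤ G.len e ^ 2 * G.dirichlet u) (e : E) {t : ℝ}
    (ht : t ∈ Set.Icc 0 (G.len e)) : ‖restr u e t‖ ^ 4 ≤ 16 * M * G.dirichlet u := by
  set D := G.dirichlet u with hDdef
  set r := √(M / D) with hr
  have hr0 : 0 < r := Real.sqrt_pos.2 (by positivity)
  have hr2 : r ^ 2 * D = M := by rw [hr, Real.sq_sqrt (by positivity)]; field_simp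
  have hrl : r ≤ G.len e :=
    Real.sqrt_le_iff.2 ⟨(G.len_pos e).le, (div_le_iff₀ hD).2 (hlen e)⟩
  have h := (isWeakDeriv_weakDeriv (hu.2 e)).norm_sq_le (continuous_restr hu.1 e) ht hr0 hrl
  have h1 : ∫ τ in Set.Ioo 0 (G.len e), ‖weakDeriv (G.len e) (restr u e) τ‖ ^ 2 ≤ D :=
    setIntegral_le_integral (f := fun e t => ‖weakDeriv (G.len e) (restr u e) t‖ ^ 2)
      (fun _ _ => by positivity) e
  have h2 : ∫ τ in Set.Ioo 0 (G.len e), ‖restr u e τ‖ ^ 2 ≤ M :=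
    (setIntegral_le_integral (f := fun e t => ‖restr u e t‖ ^ 2)
      (fun _ _ => by positivity) e).trans hmass
  have h3 : ‖restr u e t‖ ^ 2 ≤ 4 * (r * D) := by
    calc ‖restr u e t‖ ^ 2 ≤ 2 * r * D + 2 / r * M := h.trans (by gcongr)
      _ = 4 * (r * D) := by rw [← hr2]; field_simp; ring
  calc ‖restr u e t‖ ^ 4 = (‖restr u e t‖ ^ 2) ^ 2 := by ring
    _ ≤ (4 * (r * D)) ^ 2 := by gcongr
    _ = 16 * (r ^ 2 * D) * D := by ring
    _ = _ := by rw [hr2]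

theorem integral_rpow_le_of_pow_four_le {F : E → ℝ → ℝ} {p S : ℝ}
    (hp : 2 < p) (hp' : p ≤ 6) (hF : ∀ e, Continuous (F e)) (hF0 : ∀ e t, 0 ≤ F e t)
    (hS : ∀ e, ∀ t ∈ Set.Icc 0 (G.len e), F e t ^ 4 ≤ S) :
    G.integral (fun e t => F e t ^ p) ≤ (1 + S) * G.integral fun e t => F e t ^ 2 := by
  have hc : ∀ e, Continuous fun t => F e t ^ 2 := fun e => (hF e).pow 2
  calc G.integral (fun e t => F e t ^ p) ≤ G.integral fun e t => 0 + (1 + S) * F e t ^ 2 := by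
        refine integral_mono_of_continuous
          (fun e => (hF e).rpow_const fun _ => .inr (by linarith))
          (fun e => by fun_prop) fun e t ht => ?_
        refine (rpow_le_one_add_pow_four_mul_sq (hF0 e t) hp hp').trans ?_
        have := hS e t ht
        rw [zero_add]
        gcongr
    _ = _ := by rw [integral_const_add_mul hc]; ring

/-! ### The constant function -/

theorem restr_kappa (G : MetricGraph V E) (μ : ℝ) (e : E) :
    restr (G.kappa μ) e = fun _ => ((√(μ / G.length) : ℝ) : ℂ) := rfl

theorem norm_restr_kappa (G : MetricGraph V E) (μ : ℝ) (e : E) (t : ℝ) :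
    ‖restr (G.kappa μ) e t‖ = √(μ / G.length) := by
  rw [restr_kappa, Complex.norm_real, Real.norm_of_nonneg (Real.sqrt_nonneg _)]

theorem length_mul_sq_sqrt [Nonempty E] (G : MetricGraph V E) {μ : ℝ} (hμ : 0 ≤ μ) :
    G.length * √(μ / G.length) ^ 2 = μ := by
  rw [Real.sq_sqrt (div_nonneg hμ G.length_pos.le), mul_div_cancel₀ _ G.length_pos.ne']

theorem kappa_mem_H1 (G : MetricGraph V E) (μ : ℝ) : G.kappa μ ∈ G.H1 :=
  ⟨continuous_const, fun e => by
    rw [restr_kappa]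
    exact ⟨memLp_const _, _, isWeakDeriv_const (G.len_pos e).le _⟩⟩

theorem kappa_mem_H1mass [Nonempty E] (G : MetricGraph V E) {μ : ℝ} (hμ : 0 ≤ μ) :
    G.kappa μ ∈ G.H1mass μ := by
  refine ⟨G.kappa_mem_H1 μ, ?_⟩
  simp only [mass, norm_restr_kappa]
  rw [integral_const, G.length_mul_sq_sqrt hμ]

theorem energy_eq_dirichlet (p : ℝ) (u : G.Point → ℂ) :
    G.energy p u = 1 / 2 * G.dirichlet u - 1 / p * G.integral fun e t => ‖restr u e t‖ ^ p := rfl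

theorem dirichlet_kappa (G : MetricGraph V E) (μ : ℝ) : G.dirichlet (G.kappa μ) = 0 := by
  refine Finset.sum_eq_zero fun e _ => ?_
  have h := isWeakDeriv_weakDeriv ((G.kappa_mem_H1 μ).2 e)
  refine integral_eq_zero_of_ae ?_
  filter_upwards [h.ae_eq_zero_of_const (G.len_pos e).le] with t ht
  simp [ht]

theorem energy_kappa (G : MetricGraph V E) (p μ : ℝ) :
    G.energy p (G.kappa μ) = -(1 / p * (G.length * √(μ / G.length) ^ p)) := by
  simp only [energy_eq_dirichlet, dirichlet_kappa, norm_restr_kappa, integral_const]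
  ring

theorem isStationaryState_kappa (G : MetricGraph V E) (p μ : ℝ) :
    G.IsStationaryState p (G.kappa μ) := by
  -- For a constant of modulus `m` the equation forces `lam = m^(p-2)` when `m ≠ 0`.
  refine ⟨√(μ / G.length) ^ (p - 2), fun _ _ => 0, fun _ _ => 0,
    ⟨G.kappa_mem_H1 μ, fun _ => continuousOn_const,
      fun e => isWeakDeriv_const (G.len_pos e).le _,
      fun e => isWeakDeriv_const (G.len_pos e).le _, fun v => by simp⟩,
    fun e => Filter.Eventually.of_forall fun t => ?_⟩
  rw [norm_restr_kappa]
  ring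

/-! ### Energy comparison at small mass -/

theorem exists_energy_kappa_le [Nonempty E] (G : MetricGraph V E) {p : ℝ} (hp : 2 < p)
    (hp' : p ≤ 6) : ∃ M : ℝ, 0 < M ∧ ∀ μ : ℝ, 0 ≤ μ → μ < M →
      ∀ u ∈ G.H1mass μ, G.energy p (G.kappa μ) ≤ G.energy p u := by
  obtain ⟨K, hK, hosc⟩ := G.exists_norm_sub_le
  have hL := G.length_pos
  obtain ⟨e₀, he₀⟩ := Finite.exists_min G.len
  have hl₀ := G.len_pos e₀
  have hp2 : 0 < p - 2 := by linarith
  -- Chosen so that, with `B^(p-2) = A`, the remainder `ℓ · 4p B^(p-2) · K² D` equals `(p/2) D`.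
  set A : ℝ := 1 / (8 * K ^ 2 * G.length) with hA
  have hA0 : 0 < A := by positivity
  set B : ℝ := A ^ (1 / (p - 2)) with hB
  have hB0 : 0 < B := Real.rpow_pos_of_pos hA0 _
  have hBA : B ^ (p - 2) = A := by
    rw [hB, ← Real.rpow_mul hA0.le, one_div_mul_cancel hp2.ne', Real.rpow_one]
  -- `D ≤ d` means `K √D ≤ B / 2`.
  set d : ℝ := (B / (2 * K)) ^ 2 with hd
  have hd0 : 0 < d := by positivity
  -- The bounds `d / 2` and `1 / 8` close the regime of large `D`, `len² · d` fits the Sobolev scale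
  -- in the shortest edge, and `ℓ (B / 2)²` gives `m ≤ B / 2`.
  obtain ⟨M, hM, hMb⟩ : ∃ M, 0 < M ∧
      M < min (min (d / 2) (1 / 8)) (min (G.len e₀ ^ 2 * d) (G.length * (B / 2) ^ 2)) :=
    exists_between (by simp only [lt_min_iff]; refine ⟨⟨?_, ?_⟩, ?_, ?_⟩ <;> positivity)
  simp only [lt_min_iff] at hMb
  obtain ⟨⟨hMd, hM8⟩, hMl, hMB⟩ := hMb
  refine ⟨M, hM, fun μ hμ hμM u ⟨hu, hmass⟩ => ?_⟩
  set F : E → ℝ → ℝ := fun e t => ‖restr u e t‖ with hFdef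
  have hF : ∀ e, Continuous (F e) := fun e => (continuous_restr hu.1 e).norm
  have hF0 : ∀ e t, 0 ≤ F e t := fun e t => norm_nonneg _
  have hFm : G.integral (fun e t => F e t ^ 2) = μ := hmass
  set D := G.dirichlet u with hD
  have hD0 : 0 ≤ D := dirichlet_nonneg u
  set m := √(μ / G.length) with hm
  have hm0 : 0 ≤ m := Real.sqrt_nonneg _
  have hpinv : 1 / p * (p / 2) = 1 / 2 := by
    field_simp
  suffices hmain : G.integral (fun e t => F e t ^ p) ≤ G.length * m ^ p + p / 2 * D by
    rw [energy_kappa, energy_eq_dirichlet]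
    have := mul_le_mul_of_nonneg_left hmain (by positivity : 0 ≤ 1 / p)
    rw [mul_add, ← mul_assoc (1 / p) (p / 2), hpinv] at this
    linarith
  rcases le_total D d with hDd | hDd
  · have hδ : K * √D ≤ B / 2 := by
      have : √D ≤ B / (2 * K) := Real.sqrt_le_iff.2 ⟨by positivity, hDd⟩
      calc K * √D ≤ K * (B / (2 * K)) := by gcongr
        _ = B / 2 := by field_simp
    have hmB : m ≤ B / 2 := by
      refine Real.sqrt_le_iff.2 ⟨by positivity, (div_le_iff₀ hL).2 ?_⟩
      linarith
    have hmean : G.integral (fun e t => F e t ^ 2) = G.length * m ^ 2 := by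
      rw [hFm, G.length_mul_sq_sqrt hμ]
    have hclose : ∀ e, ∀ t ∈ Set.Icc 0 (G.len e), |F e t - m| ≤ K * √D := fun e t ht =>
      abs_sub_le_of_integral_sq hF hF0 hm0 hmean
        (fun e e' t ht t' ht' => (norm_sub_norm_le _ _).trans (hosc u hu e e' t ht t' ht')) e ht
    refine (integral_rpow_le_of_abs_sub_le hp hp' hF hF0 hm0 hmean hclose (by positivity)
      (by linarith : m + K * √D ≤ B)).trans (le_of_eq ?_)
    rw [hBA, mul_pow, Real.sq_sqrt hD0, hA]
    field_simp
    ring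
  · have hDpos : 0 < D := hd0.trans_le hDd
    have h4 : ∀ e, ∀ t ∈ Set.Icc 0 (G.len e), F e t ^ 4 ≤ 16 * M * D := fun e t ht =>
      norm_restr_pow_four_le hu hM (hmass.le.trans hμM.le) hDpos (fun e => by
        refine hMl.le.trans ?_
        have := he₀ e
        gcongr) e ht
    have h5 := integral_rpow_le_of_pow_four_le hp hp' hF hF0 h4
    rw [hFm] at h5
    have h6 : (1 + 16 * M * D) * μ ≤ (1 + 16 * M * D) * M := by gcongr
    -- `M ≤ D / 2` and `16 M² ≤ 1 / 4`.
    have h7 : (1 + 16 * M * D) * M ≤ D := by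
      have : M * M ≤ 1 / 8 * (1 / 8) := mul_le_mul hM8.le hM8.le hM.le (by norm_num)
      nlinarith
    have h8 : 0 ≤ G.length * m ^ p := by positivity
    have h9 : D ≤ p / 2 * D := by nlinarith
    linarith

end MetricGraph

theorem theorem2 {V E : Type*} [Fintype E] [Nonempty E] (G : MetricGraph V E)
    (p : ℝ) (hp : 2 < p) (hp' : p ≤ 6) :
    ∃ μ₂ : ℝ, 0 < μ₂ ∧ ∀ μ : ℝ, 0 ≤ μ → μ < μ₂ → G.IsGroundState p μ (G.kappa μ) := by
  obtain ⟨M, hM, h⟩ := G.exists_energy_kappa_le hp hp'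
  refine ⟨M, hM, fun μ hμ hμM => ⟨G.kappa_mem_H1mass hμ, G.isStationaryState_kappa p μ,
    le_antisymm ?_ ?_⟩⟩
  · exact le_iInf₂ fun u hu => EReal.coe_le_coe_iff.2 (h μ hμ hμM u hu)
  · exact iInf₂_le _ (G.kappa_mem_H1mass hμ)
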